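/- A \emph{ribbon graph} $G=(V,E)$ is a (compact) surface with boundary, represented as the union of two finite sets of closed discs, the set $V$ of vertices and the set $E$ of edges, such that distinct vertices are disjoint, distinct edges are disjoint, the vertices and edges intersect in disjoint line segments, each such segment lies on the boundary of precisely one vertex and precisely one edge, and every edge contains exactly two such segments. For $A\subseteq E$ let $(V,A)$ be the spanning ribbon subgraph formed by all the vertices and the edges in $A$. Let $k(G)$ be the number of connected components of $G$, and let $f(A)$ be the number of boundary components of the surface $(V,A)$. For an integer $n\ge 0$ define set systems on $E$ by $$D_{\le n}(G)=(E,\{A\subseteq E: f(A)\le k(G)+n\}),\qquad D_n(G)=(E,\{A\subseteq E: f(A)=k(G)+n\}),$$ and put $D(G)=D_0(G)$. For a set system $D=(E,\mathcal F)$ and $A\subseteq E$, the twist is $D*A=(E,\{A\triangle X: X\in\mathcal F\})$, and the dual is $D^*=D*E$. The \emph{partial dual} $G^A$ is obtained by gluing a disc to $G$ along each boundary component of $(V,A)$, regarded as a curve on the surface $G$, and removing the interiors of all the vertices of $G$; the new discs are the vertices of $G^A$, and its edges are the edges of $G$. The \emph{geometric dual} $G^*$ has as vertices a set of discs capping off the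 holes of $G$, one for each boundary component of $G$, and as edges the edges of $G$. \textbf{Theorem.} Let $G=(V,E)$ be a ribbon graph, $A\subseteq E$ and $k\ge 0$ an integer. Then $D_{\le k}(G^A)=D_{\le k}(G)*A$, and, in particular, $D(G^A)=D(G)*A$. If $G$ is orientable, then also $D_1(G^A)=D_1(G)*A$. Moreover, $D_{\le k}(G^*)=D_{\le k}(G)^*$, in particular $D(G^*)=D(G)^*$, and, if $G$ is orientable, $D_1(G^*)=D_1(G)^*$. -/

import Mathlib

open Topology unitInterval symmDiff

universe u v

/-! ### Set systems -/

/-- A set system on the ground set `E`: a collection of subsets of `E`, its feasible sets. -/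
@[ext]
structure SetSystem (E : Type v) where
  feasible : Set (Set E)

/-- The twist `D * A = (E, {A ∆ X | X feasible})`. -/
def SetSystem.twist {E : Type v} (D : SetSystem E) (A : Set E) : SetSystem E where
  feasible := {F | ∃ X ∈ D.feasible, F = A ∆ X}

/-- The dual `D* = D * E`. -/
def SetSystem.dual {E : Type v} (D : SetSystem E) : SetSystem E :=
  D.twist Set.univ

/-! ### Ribbon graphs -/

/-- The closed disc. -/
abbrev Disc : Type := Metric.closedBall (0 : ℂ) 1

/-- The boundary circle of the closed disc. -/
def Disc.circle : Set Disc := {z | ‖(z : ℂ)‖ = 1}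

/-- The interior of the closed disc. -/
def Disc.inner : Set Disc := {z | ‖(z : ℂ)‖ < 1}

/-- Edges are discs parametrised by the square `I × I`. The two end segments, `{0, 1} × I`. -/
def Square.ends : Set (I × I) := {p | p.1 = 0 ∨ p.1 = 1}

/-- The end segments without their end points. -/
def Square.openEnds : Set (I × I) := {p | (p.1 = 0 ∨ p.1 = 1) ∧ 0 < p.2 ∧ p.2 < 1}

/-- The two remaining sides of the square, `I × {0, 1}`. -/
def Square.sides : Set (I × I) := {p | p.2 = 0 ∨ p.2 = 1}

/-- The boundary circle of the square. -/
def Square.boundary : Set (I × I) := Square.ends ∪ Square.sides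

/-- A ribbon graph with edge set `E`: a space `X` that is the union of a finite family of
pairwise disjoint closed discs, the vertices, and a family of pairwise disjoint closed discs, the
edges. Each edge meets the vertices in exactly two disjoint line segments, its ends, and each end
lies on the boundary circle of one vertex (of exactly one, as the vertices are disjoint; and the
segments are disjoint, as the edges are). For finite `E` the space `X` is then
automatically a compact surface with boundary. -/
structure RibbonGraph (E : Type v) where
  /-- the underlying space of the surface -/
  X : Type u
  [top : TopologicalSpace X]
  [t2 : T2Space X]
  /-- the set of vertices -/
  V : Type u
  [finV : Finite V]
  /-- the vertex discs -/
  vert : V → Disc → X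
  /-- the edge discs -/
  edge : E → I × I → X
  vert_embedding : ∀ v, IsEmbedding (vert v)
  edge_embedding : ∀ e, IsEmbedding (edge e)
  cover : (⋃ v, Set.range (vert v)) ∪ (⋃ e, Set.range (edge e)) = Set.univ
  vert_disjoint : ∀ v w, v ≠ w → Disjoint (Set.range (vert v)) (Set.range (vert w))
  edge_disjoint : ∀ e f, e ≠ f → Disjoint (Set.range (edge e)) (Set.range (edge f))
  edge_inter : ∀ e, Set.range (edge e) ∩ (⋃ v, Set.range (vert v)) = edge e '' Square.ends
  attach : ∀ e (s : I), s = 0 ∨ s = 1 →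
    ∃ v, edge e '' {p | p.1 = s} ⊆ vert v '' Disc.circle

attribute [instance] RibbonGraph.top RibbonGraph.t2 RibbonGraph.finV

namespace RibbonGraph

variable {E : Type v}

/-- The union of the boundary circles of the vertices. -/
def vertexCircles (G : RibbonGraph.{u} E) : Set G.X :=
  ⋃ v, G.vert v '' Disc.circle

/-- The boundary of the surface: the part of the vertex circles to which no edge is attached,
together with the free sides of the edges. (The end points of an end segment are boundary points;
its other points are not.) -/
def boundary (G : RibbonGraph.{u} E) : Set G.X :=
  (G.vertexCircles \ ⋃ e, G.edge e '' Square.openEnds) ∪ ⋃ e, G.edge e '' Square.sides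

/-- `k(G)`, the number of connected components. -/
noncomputable def k (G : RibbonGraph.{u} E) : ℕ :=
  Nat.card (ConnectedComponents G.X)

/-- `f(G)`, the number of boundary components. -/
noncomputable def f (G : RibbonGraph.{u} E) : ℕ :=
  Nat.card (ConnectedComponents G.boundary)

/-- A surface is orientable if it contains no Möbius band, that is, no homeomorphic image of the
square with `(0, t)` and `(1, 1 - t)` identified. -/
def Orientable (G : RibbonGraph.{u} E) : Prop :=
  ¬ ∃ g : I × I → G.X, Continuous g ∧ ∀ p q, g p = g q ↔
    p = q ∨ (p.1 = 0 ∧ q.1 = 1 ∧ q.2 = σ p.2) ∨ (p.1 = 1 ∧ q.1 = 0 ∧ q.2 = σ p.2)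

/-- The part of the surface covered by the vertices and the edges in `A`. -/
def subsurface (G : RibbonGraph.{u} E) (A : Set E) : Set G.X :=
  (⋃ v, Set.range (G.vert v)) ∪ ⋃ e ∈ A, Set.range (G.edge e)

/-- The spanning ribbon subgraph `(V, A)`. -/
def spanning (G : RibbonGraph.{u} E) (A : Set E) : RibbonGraph.{u} A where
  X := G.subsurface A
  V := G.V
  vert v z := ⟨G.vert v z, Or.inl (Set.mem_iUnion.2 ⟨v, z, rfl⟩)⟩
  edge e p := ⟨G.edge e p, Or.inr (Set.mem_iUnion₂.2 ⟨e, e.2, p, rfl⟩)⟩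
  vert_embedding v := (G.vert_embedding v).codRestrict (G.subsurface A) _
  edge_embedding e := (G.edge_embedding e).codRestrict (G.subsurface A) _
  cover := by
    refine Set.eq_univ_of_forall ?_
    rintro ⟨x, hx⟩
    rcases hx with hx | hx
    · obtain ⟨v, z, rfl⟩ := Set.mem_iUnion.1 hx
      exact Or.inl (Set.mem_iUnion.2 ⟨v, z, rfl⟩)
    · obtain ⟨e, he, p, rfl⟩ := Set.mem_iUnion₂.1 hx
      exact Or.inr (Set.mem_iUnion.2 ⟨⟨e, he⟩, p, rfl⟩)
  vert_disjoint v w h := by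
    have := G.vert_disjoint v w h
    rw [Set.disjoint_left] at this ⊢
    rintro _ ⟨a, rfl⟩ ⟨b, hb⟩
    exact this ⟨a, rfl⟩ ⟨b, congrArg Subtype.val hb⟩
  edge_disjoint e e' h := by
    have := G.edge_disjoint e e' (fun h' => h (Subtype.ext h'))
    rw [Set.disjoint_left] at this ⊢
    rintro _ ⟨a, rfl⟩ ⟨b, hb⟩
    exact this ⟨a, rfl⟩ ⟨b, congrArg Subtype.val hb⟩
  edge_inter e := by
    have := Set.ext_iff.1 (G.edge_inter e)
    ext x
    constructor
    · rintro ⟨⟨p, rfl⟩, h⟩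
      obtain ⟨v, z, hz⟩ := Set.mem_iUnion.1 h
      obtain ⟨q, hq, h'⟩ := (this (G.edge e p)).1
        ⟨⟨p, rfl⟩, Set.mem_iUnion.2 ⟨v, z, congrArg Subtype.val hz⟩⟩
      exact ⟨q, hq, Subtype.ext h'⟩
    · rintro ⟨p, hp, rfl⟩
      obtain ⟨v, z, hz⟩ := Set.mem_iUnion.1 ((this (G.edge e p)).2 ⟨p, hp, rfl⟩).2
      exact ⟨⟨p, rfl⟩, Set.mem_iUnion.2 ⟨v, z, Subtype.ext hz⟩⟩
  attach e s hs := by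
    obtain ⟨v, hv⟩ := G.attach e s hs
    refine ⟨v, ?_⟩
    rintro _ ⟨p, hp, rfl⟩
    obtain ⟨z, hz, h⟩ := hv ⟨p, hp, rfl⟩
    exact ⟨z, hz, Subtype.ext h⟩

/-- `f(A)`, the number of boundary components of `(V, A)`. -/
noncomputable def fSub (G : RibbonGraph.{u} E) (A : Set E) : ℕ :=
  (G.spanning A).f

/-- The boundary components of `(V, A)` as curves on the surface of `G`. -/
def boundaryOn (G : RibbonGraph.{u} E) (A : Set E) : Set G.X :=
  (Subtype.val : G.subsurface A → G.X) '' (G.spanning A).boundary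

/-! ### The set systems of a ribbon graph -/

/-- `D_{≤ n}(G)`, with feasible sets the `A` such that `f(A) ≤ k(G) + n`. -/
noncomputable def spread (G : RibbonGraph.{u} E) (n : ℕ) : SetSystem E where
  feasible := {A | G.fSub A ≤ G.k + n}

/-- `D_n(G)`, with feasible sets the `A` such that `f(A) = k(G) + n`. -/
noncomputable def toggle (G : RibbonGraph.{u} E) (n : ℕ) : SetSystem E where
  feasible := {A | G.fSub A = G.k + n}

/-- `D(G) = D_0(G)`; its feasible sets are the edge sets of the spanning quasi-trees of `G`. -/
noncomputable def deltaMatroid (G : RibbonGraph.{u} E) : SetSystem E :=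
  G.toggle 0

/-! ### Partial duals and geometric duals -/

/-- `Y` is obtained from the surface `G` (embedded by `i`) by gluing one disc along each connected
component of the closed curve `C`, these discs being the vertices of `H` (embedded by `j`), and
the edges of `H` are the same discs in `Y` as those of `G`. The discs of `H` being
disjoint, their circles are the connected components of their union, so the equation
`circles` says that the discs are glued one along each component of `C`. -/
structure IsGluing (G H : RibbonGraph.{u} E) (C : Set G.X) {Y : Type u} [TopologicalSpace Y]
    (i : G.X → Y) (j : H.X → Y) : Prop where
  left_embedding : IsEmbedding i
  right_embedding : IsEmbedding j
  cover : Set.range i ∪ (⋃ w, j '' Set.range (H.vert w)) = Set.univ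
  inter : ∀ w, j '' Set.range (H.vert w) ∩ Set.range i = j '' (H.vert w '' Disc.circle)
  circles : j '' H.vertexCircles = i '' C
  edge_eq : ∀ e, j '' Set.range (H.edge e) = i '' Set.range (G.edge e)
  edge_boundary_eq : ∀ e, j '' (H.edge e '' Square.boundary) = i '' (G.edge e '' Square.boundary)

/-- `H` is the partial dual `G^A`: glue a disc to `G` along each boundary component of `(V, A)`
and remove the interiors of all the vertices of `G`; the discs are the vertices of `H`, and the
edges of `H` are those of `G`. -/
def IsPartialDual (G : RibbonGraph.{u} E) (A : Set E) (H : RibbonGraph.{u} E) : Prop :=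
  ∃ (Y : Type u) (_ : TopologicalSpace Y) (_ : T2Space Y) (i : G.X → Y) (j : H.X → Y),
    IsGluing G H (G.boundaryOn A) i j ∧
    Set.range j = (⋃ v, i '' (G.vert v '' Disc.inner))ᶜ

/-- `H` is the geometric dual `G*`: cap off the holes of `G` by discs, one for each
boundary component of `G`; then `H` consists of these discs, its vertices, and of the
edges of `G`. -/
def IsGeometricDual (G H : RibbonGraph.{u} E) : Prop :=
  ∃ (Y : Type u) (_ : TopologicalSpace Y) (_ : T2Space Y) (i : G.X → Y) (j : H.X → Y),
    IsGluing G H G.boundary i j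

end RibbonGraph

/-! ### Connected components -/

/-! Inside the glued space `Y`, the two ribbon graphs share their skeleton: the vertex circles
together with the edges. Both counts `f` and `k` can be read off from it.

For `f`: on an edge `e`, the boundary of `(V, B)` is the pair of sides if `e ∈ B` and the pair of
ends if `e ∉ B`; off the edges it is the vertex circles, whatever `B` is. The vertex circles of the
partial dual are the boundary of `(V, A)`, so ends and sides are exchanged on the edges in `A` and
kept on the others. Hence the boundary of `A ∆ B` in the dual and that of `B` in `G` are the same
subset of `Y` (`mem_boundaryOn_symmDiff`), and `fSub_symmDiff` follows.

For `k`: filling circles with discs does not change the number of components, so `k` counts the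
components of the skeleton (`card_connectedComponents_skeleton`).

The geometric dual is the case `A = E`. -/

/-- If `X` has a finite closed cover by preconnected pieces, each of which meets `Z` in a nonempty
preconnected set, and distinct pieces only intersect inside `Z`, then `Z` and `X` have equally many
connected components. -/
theorem card_connectedComponents_of_closed_cover {X ι : Type*} [TopologicalSpace X] [Finite ι]
    (P : ι → Set X) (Z : Set X) (closed : ∀ a, IsClosed (P a)) (cover : ∀ x, ∃ a, x ∈ P a)
    (conn : ∀ a, IsPreconnected (P a)) (connZ : ∀ a, IsPreconnected (P a ∩ Z))
    (ne : ∀ a, (P a ∩ Z).Nonempty) (inter : ∀ a b x, x ∈ P a → x ∈ P b → a ≠ b → x ∈ Z) :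
    Nat.card (ConnectedComponents Z) = Nat.card (ConnectedComponents X) := by
  classical
  choose p hp using ne
  choose a ha using cover
  let c : ι → ConnectedComponents Z := fun b => ConnectedComponents.mk ⟨p b, (hp b).2⟩
  have mk_eq : ∀ b x (hx : x ∈ Z), x ∈ P b → ConnectedComponents.mk ⟨x, hx⟩ = c b := by
    intro b x hx hb
    rw [ConnectedComponents.coe_eq_coe']
    have h : IsPreconnected ((Subtype.val : Z → X) ⁻¹' (P b)) := by
      rw [← Topology.IsInducing.subtypeVal.isPreconnected_image, Subtype.image_preimage_coe,
        Set.inter_comm]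
      exact connZ b
    exact h.subset_connectedComponent (x := ⟨p b, (hp b).2⟩) (hp b).1
      (show (⟨x, hx⟩ : Z) ∈ Subtype.val ⁻¹' P b from hb)
  -- The choice of piece does not matter: a point in two distinct pieces lies in `Z`, so both pieces
  -- meet the same component of `Z`. The map `r` is then a continuous retraction at the level of
  -- components, which gives injectivity below.
  let r : X → ConnectedComponents Z := fun x => c (a x)
  have r_eq : ∀ b x, x ∈ P b → r x = c b := by
    intro b x hx
    by_cases h : a x = b
    · simp only [r, h]
    · have hZ := inter _ _ x (ha x) hx h
      exact (mk_eq _ x hZ (ha x)).symm.trans (mk_eq _ x hZ hx)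
  have r_cont : Continuous r := by
    rw [continuous_iff_isClosed]
    intro S _
    have : r ⁻¹' S = ⋃ b ∈ {b | c b ∈ S}, P b := by
      ext x
      simp only [Set.mem_preimage, Set.mem_iUnion, Set.mem_ofPred_eq, exists_prop]
      exact ⟨fun h => ⟨a x, h, ha x⟩, fun ⟨b, hb, hx⟩ => by rwa [r_eq b x hx]⟩
    rw [this]
    exact (Set.toFinite _).isClosed_biUnion fun b _ => closed b
  have val_cont : Continuous (Subtype.val : Z → X) := continuous_subtype_val
  refine Nat.card_congr (Equiv.ofBijective val_cont.connectedComponentsMap ⟨?_, ?_⟩)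
  · refine Function.LeftInverse.injective (g := r_cont.connectedComponentsLift) fun q => ?_
    obtain ⟨⟨z, hz⟩, rfl⟩ := ConnectedComponents.surjective_coe q
    exact (mk_eq _ z hz (ha z)).symm
  · intro q
    obtain ⟨x, rfl⟩ := ConnectedComponents.surjective_coe q
    refine ⟨c (a x), ?_⟩
    exact ConnectedComponents.coe_eq_coe'.2
      ((conn (a x)).subset_connectedComponent (ha x) (hp (a x)).1)

theorem Homeomorph.card_connectedComponents {X Y : Type*} [TopologicalSpace X]
    [TopologicalSpace Y] (h : X ≃ₜ Y) :
    Nat.card (ConnectedComponents X) = Nat.card (ConnectedComponents Y) := by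
  refine Nat.card_congr ⟨h.continuous.connectedComponentsMap,
    h.symm.continuous.connectedComponentsMap, fun q => ?_, fun q => ?_⟩ <;>
  · obtain ⟨x, rfl⟩ := ConnectedComponents.surjective_coe q
    exact congrArg ConnectedComponents.mk (by simp)

theorem card_connectedComponents_image {X Y : Type*} [TopologicalSpace X]
    [TopologicalSpace Y] {i : X → Y} (hi : IsEmbedding i) (S : Set X) :
    Nat.card (ConnectedComponents S) = Nat.card (ConnectedComponents (i '' S)) :=
  (hi.homeomorphImage S).card_connectedComponents

/-! ### The disc and the square -/

theorem Disc.isPreconnected_circle : IsPreconnected Disc.circle := by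
  rw [← Topology.IsInducing.subtypeVal.isPreconnected_image]
  have : (Subtype.val : Disc → ℂ) '' Disc.circle = Metric.sphere (0 : ℂ) 1 := by
    ext z
    simp only [Disc.circle, Set.mem_image, Set.mem_ofPred_eq, mem_sphere_zero_iff_norm]
    constructor
    · rintro ⟨w, hw, rfl⟩
      exact hw
    · exact fun h => ⟨⟨z, by simp [h]⟩, h, rfl⟩
  rw [this]
  exact isPreconnected_sphere (by rw [Complex.rank_real_complex]; exact Nat.one_lt_ofNat) 0 1

theorem Disc.circle_nonempty : Disc.circle.Nonempty :=
  ⟨⟨1, by simp⟩, by simp [Disc.circle]⟩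

instance Disc.preconnectedSpace : PreconnectedSpace Disc :=
  Subtype.preconnectedSpace (convex_closedBall (0 : ℂ) 1).isPreconnected

instance Disc.compactSpace : CompactSpace Disc :=
  isCompact_iff_compactSpace.1 (isCompact_closedBall 0 1)

theorem Square.openEnds_eq : Square.openEnds = Square.ends \ Square.sides := by
  ext p
  simp only [openEnds, ends, sides, Set.mem_ofPred_eq, Set.mem_sdiff, not_or,
    unitInterval.pos_iff_ne_zero, unitInterval.lt_one_iff_ne_one]

theorem Square.isClosed_ends : IsClosed Square.ends :=
  (isClosed_eq continuous_fst continuous_const).union (isClosed_eq continuous_fst continuous_const)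

theorem Square.isClosed_sides : IsClosed Square.sides :=
  (isClosed_eq continuous_snd continuous_const).union (isClosed_eq continuous_snd continuous_const)

theorem unitInterval.closure_Ioo : closure (Set.Ioo (0 : I) 1) = Set.univ := by
  rw [_root_.closure_Ioo zero_ne_one]
  exact Set.Icc_bot_top

/-- Characterises the sides by the boundary circle and the ends alone. This is needed because a
gluing identifies edges as sets, with no compatibility between their parametrisations. -/
theorem Square.sides_eq_closure : Square.sides = closure (Square.boundary \ Square.ends) := by
  refine subset_antisymm ?_ (closure_minimal ?_ isClosed_sides)
  · rintro ⟨s, t⟩ h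
    have hs : (s, t) ∈ closure (Set.Ioo (0 : I) 1 ×ˢ {t}) := by
      rw [closure_prod_eq, unitInterval.closure_Ioo]
      exact ⟨trivial, subset_closure rfl⟩
    refine closure_mono ?_ hs
    rintro ⟨s', t'⟩ ⟨hs', rfl⟩
    exact ⟨Or.inr h, not_or.2 ⟨hs'.1.ne', hs'.2.ne⟩⟩
  · rintro p ⟨h | h, h'⟩
    exacts [absurd h h', h]

theorem Square.ends_eq_closure : Square.ends = closure (Square.boundary \ Square.sides) := by
  refine subset_antisymm ?_ (closure_minimal ?_ isClosed_ends)
  · rintro ⟨s, t⟩ h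
    have hs : (s, t) ∈ closure ({s} ×ˢ Set.Ioo (0 : I) 1) := by
      rw [closure_prod_eq, unitInterval.closure_Ioo]
      exact ⟨subset_closure rfl, trivial⟩
    refine closure_mono ?_ hs
    rintro ⟨s', t'⟩ ⟨rfl, ht'⟩
    exact ⟨Or.inl h, not_or.2 ⟨ht'.1.ne', ht'.2.ne⟩⟩
  · rintro p ⟨h | h, h'⟩
    exacts [h, absurd h h']

theorem Square.image_sides {Y : Type*} [TopologicalSpace Y] [T2Space Y] {g : I × I → Y}
    (hg : IsEmbedding g) :
    g '' Square.sides = closure (g '' Square.boundary \ g '' Square.ends) := by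
  rw [← Set.image_sdiff hg.injective, hg.continuous.isClosedMap.closure_image_eq_of_continuous
    hg.continuous, ← sides_eq_closure]

theorem Square.image_ends {Y : Type*} [TopologicalSpace Y] [T2Space Y] {g : I × I → Y}
    (hg : IsEmbedding g) :
    g '' Square.ends = closure (g '' Square.boundary \ g '' Square.sides) := by
  rw [← Set.image_sdiff hg.injective, hg.continuous.isClosedMap.closure_image_eq_of_continuous
    hg.continuous, ← ends_eq_closure]

/-! ### Twists -/

/-- Symmetric difference with `A` is an involution, so testing the sets `A ∆ X` tests every set. -/
theorem SetSystem.eq_twist {E : Type v} {D D' : SetSystem E} {A : Set E}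
    (h : ∀ X, A ∆ X ∈ D'.feasible ↔ X ∈ D.feasible) : D' = D.twist A := by
  ext F
  constructor
  · intro hF
    refine ⟨A ∆ F, (h _).1 ?_, ?_⟩ <;> rw [symmDiff_symmDiff_cancel_left]
    exact hF
  · rintro ⟨X, hX, rfl⟩
    exact (h X).2 hX

namespace RibbonGraph

variable {E : Type v}

/-! ### Boundary curves of spanning ribbon subgraphs -/

theorem mem_boundaryOn (G : RibbonGraph.{u} E) (B : Set E) (x : G.X) :
    x ∈ G.boundaryOn B ↔
      (x ∈ G.vertexCircles ∧ ∀ e ∈ B, x ∉ G.edge e '' Square.openEnds) ∨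
        ∃ e ∈ B, x ∈ G.edge e '' Square.sides := by
  constructor
  · rintro ⟨y, ⟨h, h'⟩ | h, rfl⟩
    · obtain ⟨v, z, hz, rfl⟩ := Set.mem_iUnion.1 h
      refine Or.inl ⟨Set.mem_iUnion.2 ⟨v, z, hz, rfl⟩, ?_⟩
      rintro e he ⟨p, hp, hpz⟩
      exact h' (Set.mem_iUnion.2 ⟨⟨e, he⟩, p, hp, Subtype.ext hpz⟩)
    · obtain ⟨e, p, hp, rfl⟩ := Set.mem_iUnion.1 h
      exact Or.inr ⟨e, e.2, p, hp, rfl⟩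
  · rintro (⟨h, h'⟩ | ⟨e, he, p, hp, rfl⟩)
    · obtain ⟨v, z, hz, rfl⟩ := Set.mem_iUnion.1 h
      refine ⟨(G.spanning B).vert v z, Or.inl ⟨Set.mem_iUnion.2 ⟨v, z, hz, rfl⟩, fun hB => ?_⟩, rfl⟩
      obtain ⟨e, p, hp, hpz⟩ := Set.mem_iUnion.1 hB
      exact h' e e.2 ⟨p, hp, congrArg Subtype.val hpz⟩
    · exact ⟨(G.spanning B).edge ⟨e, he⟩ p, Or.inr (Set.mem_iUnion.2 ⟨⟨e, he⟩, p, hp, rfl⟩), rfl⟩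

theorem boundaryOn_univ (G : RibbonGraph.{u} E) : G.boundaryOn Set.univ = G.boundary := by
  ext x
  rw [mem_boundaryOn]
  simp [boundary]

theorem edge_unique (G : RibbonGraph.{u} E) {e f : E} {x : G.X} (he : x ∈ Set.range (G.edge e))
    (hf : x ∈ Set.range (G.edge f)) : e = f := by
  by_contra h
  exact Set.disjoint_left.1 (G.edge_disjoint e f h) he hf

theorem vert_unique (G : RibbonGraph.{u} E) {v w : G.V} {x : G.X} (hv : x ∈ Set.range (G.vert v))
    (hw : x ∈ Set.range (G.vert w)) : v = w := by
  by_contra h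
  exact Set.disjoint_left.1 (G.vert_disjoint v w h) hv hw

theorem image_ends_subset_vertexCircles (G : RibbonGraph.{u} E) (e : E) :
    G.edge e '' Square.ends ⊆ G.vertexCircles := by
  rintro _ ⟨p, hp, rfl⟩
  obtain ⟨v, hv⟩ := G.attach e p.1 hp
  exact Set.mem_iUnion.2 ⟨v, hv ⟨p, rfl, rfl⟩⟩

theorem vertexCircles_subset (G : RibbonGraph.{u} E) :
    G.vertexCircles ⊆ ⋃ v, Set.range (G.vert v) :=
  Set.iUnion_mono fun _ => Set.image_subset_range _ _

theorem mem_vertexCircles_iff_of_mem_edge (G : RibbonGraph.{u} E) {e : E} {x : G.X}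
    (he : x ∈ Set.range (G.edge e)) :
    x ∈ G.vertexCircles ↔ x ∈ G.edge e '' Square.ends := by
  refine ⟨fun h => ?_, fun h => G.image_ends_subset_vertexCircles e h⟩
  rw [← G.edge_inter e]
  exact ⟨he, G.vertexCircles_subset h⟩

/-- On the edge `e`, the boundary of `(V, B)` consists of the free sides if `e ∈ B`. -/
theorem mem_boundaryOn_iff_sides (G : RibbonGraph.{u} E) {B : Set E} {e : E} (heB : e ∈ B)
    {x : G.X} (he : x ∈ Set.range (G.edge e)) :
    x ∈ G.boundaryOn B ↔ x ∈ G.edge e '' Square.sides := by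
  rw [mem_boundaryOn, G.mem_vertexCircles_iff_of_mem_edge he]
  constructor
  · rintro (⟨h, h'⟩ | ⟨f, -, h⟩)
    · have := h' e heB
      -- A point of the ends outside the open ends is a corner, and corners belong to the sides.
      rw [Square.openEnds_eq, Set.image_sdiff (G.edge_embedding e).injective] at this
      by_contra hs
      exact this ⟨h, hs⟩
    · rwa [G.edge_unique he (Set.image_subset_range _ _ h)]
  · exact fun h => Or.inr ⟨e, heB, h⟩

/-- On the edge `e`, the boundary of `(V, B)` consists of the end segments if `e ∉ B`. -/
theorem mem_boundaryOn_iff_ends (G : RibbonGraph.{u} E) {B : Set E} {e : E} (heB : e ∉ B)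
    {x : G.X} (he : x ∈ Set.range (G.edge e)) :
    x ∈ G.boundaryOn B ↔ x ∈ G.edge e '' Square.ends := by
  rw [mem_boundaryOn, G.mem_vertexCircles_iff_of_mem_edge he]
  constructor
  · rintro (⟨h, -⟩ | ⟨f, hf, h⟩)
    · exact h
    · exact absurd (G.edge_unique he (Set.image_subset_range _ _ h) ▸ hf) heB
  · refine fun h => Or.inl ⟨h, fun f hf h' => heB ?_⟩
    rwa [G.edge_unique he (Set.image_subset_range _ _ h')]

/-- Away from the edges, the boundary of `(V, B)` consists of the vertex circles. -/
theorem mem_boundaryOn_iff_vertexCircles (G : RibbonGraph.{u} E) {B : Set E} {x : G.X}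
    (hx : ∀ e, x ∉ Set.range (G.edge e)) : x ∈ G.boundaryOn B ↔ x ∈ G.vertexCircles := by
  rw [mem_boundaryOn]
  constructor
  · rintro (⟨h, -⟩ | ⟨e, -, h⟩)
    exacts [h, absurd (Set.image_subset_range _ _ h) (hx e)]
  · exact fun h => Or.inl ⟨h, fun e _ h' => hx e (Set.image_subset_range _ _ h')⟩

theorem fSub_eq (G : RibbonGraph.{u} E) (B : Set E) :
    G.fSub B = Nat.card (ConnectedComponents (G.boundaryOn B)) :=
  card_connectedComponents_image IsEmbedding.subtypeVal _

/-! ### Components of a ribbon graph -/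

/-- The surface without the interiors of the vertices. -/
def skeleton (G : RibbonGraph.{u} E) : Set G.X :=
  G.vertexCircles ∪ ⋃ e, Set.range (G.edge e)

theorem boundaryOn_subset_skeleton (G : RibbonGraph.{u} E) (B : Set E) :
    G.boundaryOn B ⊆ G.skeleton := by
  intro x hx
  rcases (G.mem_boundaryOn B x).1 hx with ⟨h, -⟩ | ⟨e, -, h⟩
  · exact Or.inl h
  · exact Or.inr (Set.mem_iUnion.2 ⟨e, Set.image_subset_range _ _ h⟩)

theorem vert_range_inter_skeleton (G : RibbonGraph.{u} E) (v : G.V) :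
    Set.range (G.vert v) ∩ G.skeleton = G.vert v '' Disc.circle := by
  have key : ∀ x ∈ Set.range (G.vert v), x ∈ G.vertexCircles → x ∈ G.vert v '' Disc.circle := by
    intro x hx h
    obtain ⟨w, hw⟩ := Set.mem_iUnion.1 h
    rwa [G.vert_unique hx (Set.image_subset_range _ _ hw)]
  refine subset_antisymm ?_ fun x hx =>
    ⟨Set.image_subset_range _ _ hx, Or.inl (Set.mem_iUnion.2 ⟨v, hx⟩)⟩
  rintro x ⟨hx, h | h⟩
  · exact key x hx h
  · obtain ⟨e, he⟩ := Set.mem_iUnion.1 h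
    refine key x hx (G.image_ends_subset_vertexCircles e ?_)
    rw [← G.edge_inter e]
    exact ⟨he, Set.mem_iUnion.2 ⟨v, hx⟩⟩

/-- The cover is by all vertex and edge discs. They meet the skeleton in a circle or in the whole
edge, and as vertices are disjoint, any overlap of two distinct discs lies on an edge. -/
theorem card_connectedComponents_skeleton [Finite E] (G : RibbonGraph.{u} E) :
    Nat.card (ConnectedComponents G.skeleton) = G.k := by
  have edge_inter : ∀ e, Set.range (G.edge e) ∩ G.skeleton = Set.range (G.edge e) := fun e =>
    Set.inter_eq_left.2 fun x hx => Or.inr (Set.mem_iUnion.2 ⟨e, hx⟩)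
  refine card_connectedComponents_of_closed_cover
    (Sum.elim (fun v => Set.range (G.vert v)) fun e => Set.range (G.edge e)) G.skeleton
    ?_ ?_ ?_ ?_ ?_ ?_
  · rintro (v | e)
    exacts [(isCompact_range (G.vert_embedding v).continuous).isClosed,
      (isCompact_range (G.edge_embedding e).continuous).isClosed]
  · intro x
    have hx : x ∈ Set.univ := trivial
    rw [← G.cover] at hx
    rcases hx with hx | hx
    · obtain ⟨v, hv⟩ := Set.mem_iUnion.1 hx
      exact ⟨Sum.inl v, hv⟩
    · obtain ⟨e, he⟩ := Set.mem_iUnion.1 hx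
      exact ⟨Sum.inr e, he⟩
  · rintro (v | e)
    exacts [isPreconnected_range (G.vert_embedding v).continuous,
      isPreconnected_range (G.edge_embedding e).continuous]
  · rintro (v | e)
    · simp only [Sum.elim_inl, vert_range_inter_skeleton]
      exact Disc.isPreconnected_circle.image _ (G.vert_embedding v).continuous.continuousOn
    · simp only [Sum.elim_inr, edge_inter]
      exact isPreconnected_range (G.edge_embedding e).continuous
  · rintro (v | e)
    · simp only [Sum.elim_inl, vert_range_inter_skeleton]
      exact Disc.circle_nonempty.image _
    · simp only [Sum.elim_inr, edge_inter]
      exact Set.range_nonempty _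
  · rintro (v | e) (w | f) x hx hx' h
    · exact absurd (congrArg Sum.inl (G.vert_unique hx hx')) h
    · exact Or.inr (Set.mem_iUnion.2 ⟨f, hx'⟩)
    · exact Or.inr (Set.mem_iUnion.2 ⟨e, hx⟩)
    · exact Or.inr (Set.mem_iUnion.2 ⟨e, hx⟩)

/-! ### Gluings along the boundary of a spanning ribbon subgraph -/

namespace IsGluing

variable {G H : RibbonGraph.{u} E} {A : Set E} {Y : Type u} [TopologicalSpace Y]
  {i : G.X → Y} {j : H.X → Y}

theorem mem_edge_iff {C : Set G.X} (h : IsGluing G H C i j) {x : G.X} {y : H.X} (hxy : j y = i x)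
    (e : E) : y ∈ Set.range (H.edge e) ↔ x ∈ Set.range (G.edge e) := by
  rw [← h.right_embedding.injective.mem_set_image, h.edge_eq, hxy,
    h.left_embedding.injective.mem_set_image]

theorem mem_vertexCircles_iff {C : Set G.X} (h : IsGluing G H C i j) {x : G.X} {y : H.X}
    (hxy : j y = i x) : y ∈ H.vertexCircles ↔ x ∈ C := by
  rw [← h.right_embedding.injective.mem_set_image, h.circles, hxy,
    h.left_embedding.injective.mem_set_image]

theorem exists_of_mem_edge {C : Set G.X} (h : IsGluing G H C i j) {e : E} {y : H.X}
    (hy : y ∈ Set.range (H.edge e)) : ∃ x ∈ Set.range (G.edge e), i x = j y := by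
  have := Set.mem_image_of_mem j hy
  rwa [h.edge_eq] at this

/-- The end segments of an edge of `H` are the part of it that lies on the glueing curve. -/
theorem image_ends {C : Set G.X} (h : IsGluing G H C i j) (e : E) :
    j '' (H.edge e '' Square.ends) = i '' (Set.range (G.edge e) ∩ C) := by
  ext z
  constructor
  · rintro ⟨y, hy, rfl⟩
    have hye := Set.image_subset_range _ _ hy
    obtain ⟨x, hx, hxy⟩ := h.exists_of_mem_edge hye
    exact ⟨x, ⟨hx, (h.mem_vertexCircles_iff hxy.symm).1
      (H.image_ends_subset_vertexCircles e hy)⟩, hxy⟩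
  · rintro ⟨x, ⟨hx, hC⟩, rfl⟩
    have hx' := Set.mem_image_of_mem i hx
    rw [← h.edge_eq] at hx'
    obtain ⟨y, hy, hxy⟩ := hx'
    exact ⟨y, (H.mem_vertexCircles_iff_of_mem_edge hy).1 ((h.mem_vertexCircles_iff hxy).2 hC), hxy⟩

theorem image_ends_of_mem (h : IsGluing G H (G.boundaryOn A) i j) {e : E} (he : e ∈ A) :
    j '' (H.edge e '' Square.ends) = i '' (G.edge e '' Square.sides) := by
  rw [h.image_ends]
  congr 1
  ext x
  exact ⟨fun hx => (G.mem_boundaryOn_iff_sides he hx.1).1 hx.2, fun hx =>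
    ⟨Set.image_subset_range _ _ hx,
      (G.mem_boundaryOn_iff_sides he (Set.image_subset_range _ _ hx)).2 hx⟩⟩

theorem image_ends_of_notMem (h : IsGluing G H (G.boundaryOn A) i j) {e : E} (he : e ∉ A) :
    j '' (H.edge e '' Square.ends) = i '' (G.edge e '' Square.ends) := by
  rw [h.image_ends]
  congr 1
  ext x
  exact ⟨fun hx => (G.mem_boundaryOn_iff_ends he hx.1).1 hx.2, fun hx =>
    ⟨Set.image_subset_range _ _ hx,
      (G.mem_boundaryOn_iff_ends he (Set.image_subset_range _ _ hx)).2 hx⟩⟩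

/-- The gluing controls only the ends and the whole boundary circle of an edge; the sides are
recovered in `Y` as the closure of their difference. -/
theorem image_sides_of_mem [T2Space Y] (h : IsGluing G H (G.boundaryOn A) i j) {e : E}
    (he : e ∈ A) : j '' (H.edge e '' Square.sides) = i '' (G.edge e '' Square.ends) := by
  have h₁ := h.image_ends_of_mem he
  have h₂ := h.edge_boundary_eq e
  simp only [← Set.image_comp] at h₁ h₂ ⊢
  rw [Square.image_sides (h.right_embedding.comp (H.edge_embedding e)),
    Square.image_ends (h.left_embedding.comp (G.edge_embedding e)), h₁, h₂]

theorem image_sides_of_notMem [T2Space Y] (h : IsGluing G H (G.boundaryOn A) i j) {e : E}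
    (he : e ∉ A) : j '' (H.edge e '' Square.sides) = i '' (G.edge e '' Square.sides) := by
  have h₁ := h.image_ends_of_notMem he
  have h₂ := h.edge_boundary_eq e
  simp only [← Set.image_comp] at h₁ h₂ ⊢
  rw [Square.image_sides (h.right_embedding.comp (H.edge_embedding e)),
    Square.image_sides (h.left_embedding.comp (G.edge_embedding e)), h₁, h₂]

/-- The hypothesis `hxy` says that `x` and `y` are one point of `Y`. On an edge in `A`, membership
in `A ∆ B` is opposite to membership in `B`, and this cancels the exchange of ends and sides; on
other edges neither changes. -/
theorem mem_boundaryOn_symmDiff [T2Space Y] (h : IsGluing G H (G.boundaryOn A) i j) (B : Set E)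
    {x : G.X} {y : H.X} (hxy : j y = i x) : y ∈ H.boundaryOn (A ∆ B) ↔ x ∈ G.boundaryOn B := by
  have transfer : ∀ {S : Set H.X} {T : Set G.X}, j '' S = i '' T → (y ∈ S ↔ x ∈ T) := by
    intro S T hST
    rw [← h.right_embedding.injective.mem_set_image, hST, hxy,
      h.left_embedding.injective.mem_set_image]
  by_cases hx : ∃ e, x ∈ Set.range (G.edge e)
  · obtain ⟨e, hx⟩ := hx
    have hy := (h.mem_edge_iff hxy e).2 hx
    by_cases hA : e ∈ A <;> by_cases hB : e ∈ B
    · have : e ∉ A ∆ B := by simp [Set.mem_symmDiff, hA, hB]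
      rw [H.mem_boundaryOn_iff_ends this hy, G.mem_boundaryOn_iff_sides hB hx]
      exact transfer (h.image_ends_of_mem hA)
    · have : e ∈ A ∆ B := by simp [Set.mem_symmDiff, hA, hB]
      rw [H.mem_boundaryOn_iff_sides this hy, G.mem_boundaryOn_iff_ends hB hx]
      exact transfer (h.image_sides_of_mem hA)
    · have : e ∈ A ∆ B := by simp [Set.mem_symmDiff, hA, hB]
      rw [H.mem_boundaryOn_iff_sides this hy, G.mem_boundaryOn_iff_sides hB hx]
      exact transfer (h.image_sides_of_notMem hA)
    · have : e ∉ A ∆ B := by simp [Set.mem_symmDiff, hA, hB]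
      rw [H.mem_boundaryOn_iff_ends this hy, G.mem_boundaryOn_iff_ends hB hx]
      exact transfer (h.image_ends_of_notMem hA)
  -- Off the edges, the vertex circles of `H`, the boundary of `(V, A)` and the vertex circles of
  -- `G` all agree.
  · push Not at hx
    have hy : ∀ e, y ∉ Set.range (H.edge e) := fun e => mt (h.mem_edge_iff hxy e).1 (hx e)
    rw [H.mem_boundaryOn_iff_vertexCircles hy, h.mem_vertexCircles_iff hxy,
      G.mem_boundaryOn_iff_vertexCircles hx, G.mem_boundaryOn_iff_vertexCircles hx]

theorem mem_skeleton (h : IsGluing G H (G.boundaryOn A) i j) {x : G.X} {y : H.X}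
    (hxy : j y = i x) : y ∈ H.skeleton ↔ x ∈ G.skeleton := by
  simp only [skeleton, Set.mem_union, Set.mem_iUnion, h.mem_edge_iff hxy,
    h.mem_vertexCircles_iff hxy]
  by_cases hx : ∃ e, x ∈ Set.range (G.edge e)
  · simp only [hx, or_true]
  · have hx' := hx
    push Not at hx'
    simp only [hx, or_false]
    exact G.mem_boundaryOn_iff_vertexCircles hx'

theorem exists_eq_of_mem_right_skeleton {C : Set G.X} (h : IsGluing G H C i j) {y : H.X}
    (hy : y ∈ H.skeleton) : ∃ x, j y = i x := by
  rcases hy with hy | hy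
  · have := Set.mem_image_of_mem j hy
    rw [h.circles] at this
    obtain ⟨x, -, hx⟩ := this
    exact ⟨x, hx.symm⟩
  · obtain ⟨e, he⟩ := Set.mem_iUnion.1 hy
    obtain ⟨x, -, hx⟩ := h.exists_of_mem_edge he
    exact ⟨x, hx.symm⟩

/-- No skeleton point is lost: edges are kept, and a vertex circle point off the edges lies on the
gluing curve for every `A`. -/
theorem exists_eq_of_mem_left_skeleton (h : IsGluing G H (G.boundaryOn A) i j) {x : G.X}
    (hx : x ∈ G.skeleton) : ∃ y, j y = i x := by
  by_cases he : ∃ e, x ∈ Set.range (G.edge e)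
  · obtain ⟨e, he⟩ := he
    have := Set.mem_image_of_mem i he
    rw [← h.edge_eq] at this
    obtain ⟨y, -, hy⟩ := this
    exact ⟨y, hy⟩
  · have hC : x ∈ G.vertexCircles := hx.resolve_right fun h' => he (Set.mem_iUnion.1 h')
    push Not at he
    have := Set.mem_image_of_mem i ((G.mem_boundaryOn_iff_vertexCircles (B := A) he).2 hC)
    rw [← h.circles] at this
    obtain ⟨y, -, hy⟩ := this
    exact ⟨y, hy⟩

/-- Corresponding parts of the two skeletons have equally many connected components. -/
theorem card_connectedComponents_eq (h : IsGluing G H (G.boundaryOn A) i j) {S : Set H.X}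
    {T : Set G.X} (hS : S ⊆ H.skeleton) (hT : T ⊆ G.skeleton)
    (hST : ∀ x y, j y = i x → (y ∈ S ↔ x ∈ T)) :
    Nat.card (ConnectedComponents S) = Nat.card (ConnectedComponents T) := by
  have : j '' S = i '' T := by
    ext z
    constructor
    · rintro ⟨y, hy, rfl⟩
      obtain ⟨x, hx⟩ := h.exists_eq_of_mem_right_skeleton (hS hy)
      exact ⟨x, (hST x y hx).1 hy, hx.symm⟩
    · rintro ⟨x, hx, rfl⟩
      obtain ⟨y, hy⟩ := h.exists_eq_of_mem_left_skeleton (hT hx)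
      exact ⟨y, (hST x y hy).2 hx, hy⟩
  rw [card_connectedComponents_image h.right_embedding,
    card_connectedComponents_image h.left_embedding, this]

theorem fSub_symmDiff [T2Space Y] (h : IsGluing G H (G.boundaryOn A) i j) (B : Set E) :
    H.fSub (A ∆ B) = G.fSub B := by
  rw [fSub_eq, fSub_eq]
  exact h.card_connectedComponents_eq (H.boundaryOn_subset_skeleton _)
    (G.boundaryOn_subset_skeleton _) fun _ _ hxy => h.mem_boundaryOn_symmDiff B hxy

theorem k_eq [Finite E] (h : IsGluing G H (G.boundaryOn A) i j) : H.k = G.k := by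
  rw [← card_connectedComponents_skeleton, ← card_connectedComponents_skeleton]
  exact h.card_connectedComponents_eq subset_rfl subset_rfl fun _ _ hxy => h.mem_skeleton hxy

theorem spread_eq_twist [Finite E] [T2Space Y] (h : IsGluing G H (G.boundaryOn A) i j) (n : ℕ) :
    H.spread n = (G.spread n).twist A :=
  SetSystem.eq_twist fun X => by
    simp only [spread, Set.mem_ofPred_eq, h.fSub_symmDiff, h.k_eq]

theorem toggle_eq_twist [Finite E] [T2Space Y] (h : IsGluing G H (G.boundaryOn A) i j) (n : ℕ) :
    H.toggle n = (G.toggle n).twist A :=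
  SetSystem.eq_twist fun X => by
    simp only [toggle, Set.mem_ofPred_eq, h.fSub_symmDiff, h.k_eq]

end IsGluing

end RibbonGraph

theorem theoremt {E : Type v} [Finite E] (G : RibbonGraph.{u} E) :
    (∀ (A : Set E) (H : RibbonGraph.{u} E), G.IsPartialDual A H →
      (∀ k : ℕ, H.spread k = (G.spread k).twist A) ∧
      H.deltaMatroid = G.deltaMatroid.twist A ∧
      (G.Orientable → H.toggle 1 = (G.toggle 1).twist A)) ∧
    (∀ H : RibbonGraph.{u} E, G.IsGeometricDual H →
      (∀ k : ℕ, H.spread k = (G.spread k).dual) ∧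
      H.deltaMatroid = G.deltaMatroid.dual ∧
      (G.Orientable → H.toggle 1 = (G.toggle 1).dual)) := by
  constructor
  · rintro A H ⟨Y, _, _, i, j, h, -⟩
    exact ⟨h.spread_eq_twist, h.toggle_eq_twist 0, fun _ => h.toggle_eq_twist 1⟩
  · rintro H ⟨Y, _, _, i, j, h⟩
    -- Capping the holes of `G` is gluing along the boundary of `(V, E)`, and `dual` is by
    -- definition the twist by `Set.univ`.
    rw [← G.boundaryOn_univ] at h
    exact ⟨h.spread_eq_twist, h.toggle_eq_twist 0, fun _ => h.toggle_eq_twist 1⟩
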